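/- Theorem 3.1. Let $G(x)=\frac12 e^{-|x|}$, $s>\frac32$, $T>0$ and $u_0,v_0,w_0\in H^s(\mathbb{R})$. Let $z=(u,v,w)\in C([0,T];H^s(\mathbb{R})\times H^s(\mathbb{R})\times H^s(\mathbb{R}))$ be real-valued and solve on $[0,T]\times\mathbb{R}$ the three-component Camassa–Holm system $$\begin{cases} u_t+(u+v+w)u_x+G*(uv_x+uw_x)+\partial_xG*f=0,\\ v_t+(u+v+w)v_x+G*(vu_x+vw_x)+\partial_xG*g=0,\\ w_t+(u+v+w)w_x+G*(wu_x+wv_x)+\partial_xG*h=0,\end{cases}$$ with initial data $(u,v,w)|_{t=0}=(u_0,v_0,w_0)$, where $*$ is convolution in $x$ and $$\begin{aligned} f&=u^2+\tfrac12u_x^2+u_xv_x+u_xw_x+\tfrac12v^2-\tfrac12v_x^2+\tfrac12w^2-\tfrac12w_x^2,\\ g&=v^2+\tfrac12v_x^2+u_xv_x+v_xw_x+\tfrac12u^2-\tfrac12u_x^2+\tfrac12w^2-\tfrac12w_x^2,\\ h&=w^2+\tfrac12w_x^2+u_xw_x+v_xw_x+\tfrac12u^2-\tfrac12u_x^2+\tfrac12v^2-\tfrac12v_x^2.\end{aligned}$$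 Here elements of $H^s(\mathbb{R})$ are identified with their continuous (hence $C^1$) representatives, and the equations hold at every $(t,x)\in[0,T]\times\mathbb{R}$, with one-sided time derivatives at $t=0$ and $t=T$. Suppose that for some $\alpha\in(0,1)$ each of $u_0,v_0,w_0,u_{0x},v_{0x},w_{0x}$ is $O(e^{\alpha x})$ as $x\to-\infty$. Then each of $u(t,x),v(t,x),w(t,x),u_x(t,x),v_x(t,x),w_x(t,x)$ is $O(e^{\alpha x})$ as $x\to-\infty$, uniformly in $t\in[0,T]$; that is, there are $K>0$ and $X\in\mathbb{R}$ such that all six are bounded in absolute value by $Ke^{\alpha x}$ for all $t\in[0,T]$ and all $x\le X$. -/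

import Mathlib

open MeasureTheory Set Filter TemperedDistribution
open scoped Topology SchwartzMap ENNReal

namespace ThreeCH

noncomputable section

/-- The real function `f`, viewed as a complex-valued function on the line. -/
def cplx (f : ℝ → ℝ) : ℝ → ℂ := fun x => (f x : ℂ)

/-- `f ∈ H^s(ℝ)` (for `s ≥ 0`): `f` is square integrable, and the tempered distribution it defines
belongs to the Bessel potential space of order `s` over `L²`. -/
def MemHs (s : ℝ) (f : ℝ → ℝ) : Prop :=
  ∃ hf : MemLp (cplx f) 2 (volume : Measure ℝ),
    MemSobolev s 2 ((hf.toLp (cplx f) : Lp ℂ 2 (volume : Measure ℝ)) : 𝓢'(ℝ, ℂ))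

/-- `u ∈ C([0,T]; H^s(ℝ))` (for `s ≥ 0`). The norm of `H^s` is the `L²` norm of the Bessel potential
of order `s`, so `u` is a continuous curve in `H^s` iff each `u t` is in `L²`, its Bessel potential
is an element `U t` of `L²`, and `t ↦ U t` is continuous into `L²` on `[0,T]`. -/
def ContinuousInHs (s T : ℝ) (u : ℝ → ℝ → ℝ) : Prop :=
  ∃ U : ℝ → Lp ℂ 2 (volume : Measure ℝ), ContinuousOn U (Icc 0 T) ∧
    ∀ t ∈ Icc (0 : ℝ) T, ∃ hf : MemLp (cplx (u t)) 2 (volume : Measure ℝ),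
      besselPotential ℝ ℂ s
          ((hf.toLp (cplx (u t)) : Lp ℂ 2 (volume : Measure ℝ)) : 𝓢'(ℝ, ℂ)) =
        ((U t : Lp ℂ 2 (volume : Measure ℝ)) : 𝓢'(ℝ, ℂ))

/-- The Green function `G(x) = e^{-|x|} / 2` of `1 - ∂ₓ²` on the line. -/
def green (x : ℝ) : ℝ := (1 / 2) * Real.exp (-|x|)

/-- Convolution `(k ∗ f)(x) = ∫ k(y) f(x - y) dy` of real functions on the line. -/
def conv (k f : ℝ → ℝ) : ℝ → ℝ :=
  convolution k f (ContinuousLinearMap.mul ℝ ℝ) volume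

/-- The quadratic expression
`a² + aₓ²/2 + aₓ bₓ + aₓ cₓ + b²/2 - bₓ²/2 + c²/2 - cₓ²/2`.
With `(a, b, c) = (u, v, w)`, `(v, u, w)`, `(w, u, v)` it is `f`, `g`, `h` respectively. -/
def quad (a b c : ℝ → ℝ) (x : ℝ) : ℝ :=
  a x ^ 2 + (1 / 2) * deriv a x ^ 2 + deriv a x * deriv b x + deriv a x * deriv c x
    + (1 / 2) * b x ^ 2 - (1 / 2) * deriv b x ^ 2
    + (1 / 2) * c x ^ 2 - (1 / 2) * deriv c x ^ 2

/-- The spatial part `(a + b + c) aₓ + G ∗ (a bₓ + a cₓ) + (∂ₓG) ∗ quad(a, b, c)` of the evolution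
equation for the component `a`. The value of `deriv green` at the single point `0` does not affect
the convolution. -/
def spatialPart (a b c : ℝ → ℝ) (x : ℝ) : ℝ :=
  (a x + b x + c x) * deriv a x
    + conv green (fun y => a y * deriv b y + a y * deriv c y) x
    + conv (deriv green) (quad a b c) x

/-- `(u, v, w) ∈ C([0,T]; H^s × H^s × H^s)` solves the three-component Camassa--Holm system in its
nonlocal form on `[0,T]` with initial data `(u₀, v₀, w₀)`.

An element of `H^s`, `s > 3/2`, is a class of functions that has exactly one continuous
representative (which is then `C¹`); `u t`, `v t`, `w t` denote these representatives.
The equations hold at every `(t, x)`, one-sidedly in time at `t = 0` and `t = T`. If the curve is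
`C¹` into `H^{s-1}` and satisfies the equations in `H^{s-1}`, then they hold in this sense, since
`H^{s-1}` embeds into the bounded continuous functions. -/
structure IsSolution (s T : ℝ) (u₀ v₀ w₀ : ℝ → ℝ) (u v w : ℝ → ℝ → ℝ) : Prop where
  u_mem : ContinuousInHs s T u
  v_mem : ContinuousInHs s T v
  w_mem : ContinuousInHs s T w
  u_cont : ∀ t ∈ Icc (0 : ℝ) T, Continuous (u t)
  v_cont : ∀ t ∈ Icc (0 : ℝ) T, Continuous (v t)
  w_cont : ∀ t ∈ Icc (0 : ℝ) T, Continuous (w t)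
  u_eq : ∀ t ∈ Icc (0 : ℝ) T, ∀ x : ℝ,
    HasDerivWithinAt (fun τ => u τ x) (-spatialPart (u t) (v t) (w t) x) (Icc 0 T) t
  v_eq : ∀ t ∈ Icc (0 : ℝ) T, ∀ x : ℝ,
    HasDerivWithinAt (fun τ => v τ x) (-spatialPart (v t) (u t) (w t) x) (Icc 0 T) t
  w_eq : ∀ t ∈ Icc (0 : ℝ) T, ∀ x : ℝ,
    HasDerivWithinAt (fun τ => w τ x) (-spatialPart (w t) (u t) (v t) x) (Icc 0 T) t
  u_init : u 0 = u₀
  v_init : v 0 = v₀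
  w_init : w 0 = w₀

/-- `φ(x) = O(e^{αx})` as `x → -∞`. -/
def ExpDecay (α : ℝ) (φ : ℝ → ℝ) : Prop :=
  φ =O[atBot] fun x => Real.exp (α * x)

/-- `φ(t, x) = O(e^{αx})` as `x → -∞`, uniformly for `t ∈ [0,T]`: one constant and one threshold
serve all times. -/
def UnifExpDecay (α T : ℝ) (φ : ℝ → ℝ → ℝ) : Prop :=
  ∃ K : ℝ, 0 < K ∧ ∃ X : ℝ, ∀ x ≤ X, ∀ t ∈ Icc (0 : ℝ) T, |φ t x| ≤ K * Real.exp (α * x)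

end

end ThreeCH

/-!
Decay at `-∞` is propagated along the characteristics of the transport velocity `u + v + w`.

By the Sobolev embedding (`sobolev_embedding`, a Cauchy--Schwarz estimate on the Fourier side) the
solution is bounded in `C¹`, uniformly in time, and `uₓ`, `vₓ`, `wₓ` are jointly continuous
(`ContinuousInHs.exists_bddC1`). So the velocity is bounded and Lipschitz, characteristics exist on
all of `[0,T]`, and along them each component `a` satisfies `(d/dt) a = -F`, where `F` is the nonlocal
part of its equation. Differentiating the equation in `x` would bring in `aₓₓ`, which need not exist
for `s` near `3/2`; instead the difference of `a` along two characteristics that pass through `y` and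
`y + d` at the same time is estimated and divided by `d`.

Decay is measured with a weight `ψ` that changes by at most the factor `e^{α|x-y|}` between `x` and
`y`. Since `G` and `∂ₓG` have size `e^{-|x|} / 2` and `α < 1`, convolution with them maps functions
bounded by `ψ` to functions bounded by a multiple of `ψ`, and difference quotients of the result are
again bounded by a multiple of `ψ` (`abs_conv_le`, `abs_conv_sub_le`). In each quadratic
nonlinearity one factor is bounded by the `C¹` bound and the other by `ψ`, so
`nonlocalPart_bounds` is linear in the weighted bound. Characteristics move a point by a bounded
distance, over which `ψ` is comparable to itself. Hence a bound of the six functions by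
`B e^{Lt} ψ` implies a bound by `(C A + (C / L) B) e^{Lt} ψ`, with `A` from the initial data
(`component_estimate`). For `L = 2C` iteration of `B ↦ C A + B / 2` leads to the bound
`2 C A e^{Lt} ψ` (`exists_weighted_bound`).

The iteration has to start from some finite `B`. This is available for `ψ(x) = e^{αx} + ε`, which is
bounded below by `ε`; the resulting constant does not depend on `ε`, and `ε → 0` gives the theorem.
-/

namespace ThreeCH

noncomputable section

/-! ### Sobolev embedding of `H^s` into `C¹` for `s > 3/2` -/

open FourierTransform

lemma continuous_japanese (r : ℝ) : Continuous fun ξ : ℝ => (1 + ξ ^ 2) ^ r :=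
  Continuous.rpow_const (by fun_prop) fun x => Or.inl (by positivity)

lemma memLp_two_japanese {r : ℝ} (hr : 1 / 2 < r) :
    MemLp (fun ξ : ℝ => (1 + ξ ^ 2) ^ (-r / 2)) 2 := by
  rw [memLp_two_iff_integrable_sq (continuous_japanese _).aestronglyMeasurable]
  have h := integrable_rpow_neg_one_add_norm_sq (E := ℝ) (μ := volume) (r := 2 * r)
    (by simp; linarith)
  refine h.congr (ae_of_all _ fun x => ?_)
  simp only [Real.norm_eq_abs, sq_abs]
  rw [← Real.rpow_mul_natCast (by positivity)]
  congr 1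
  push_cast
  ring

lemma memLp_two_id_mul_japanese {s : ℝ} (hs : 3 / 2 < s) :
    MemLp (fun ξ : ℝ => ξ * (1 + ξ ^ 2) ^ (-s / 2)) 2 := by
  refine (memLp_two_japanese (r := s - 1) (by linarith)).mono
    (continuous_id.mul (continuous_japanese _)).aestronglyMeasurable (ae_of_all _ fun x => ?_)
  have h0 : (0 : ℝ) < 1 + x ^ 2 := by positivity
  rw [norm_mul, Real.norm_of_nonneg (Real.rpow_nonneg h0.le _),
    Real.norm_of_nonneg (Real.rpow_nonneg h0.le _)]
  have : (1 + x ^ 2) ^ (-(s - 1) / 2) = (1 + x ^ 2) ^ (1 / 2 : ℝ) * (1 + x ^ 2) ^ (-s / 2) := by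
    rw [← Real.rpow_add h0]; congr 1; ring
  rw [this]
  gcongr
  rw [← Real.sqrt_eq_rpow, Real.norm_eq_abs]
  exact Real.abs_le_sqrt (by linarith)

/-- Multiplication formula for the inverse Fourier transform of an integrable function. -/
lemma integral_fourierInv_mul_eq {h : ℝ → ℂ} (hh : Integrable h) (φ : 𝓢(ℝ, ℂ)) :
    ∫ ξ, (𝓕⁻ φ : 𝓢(ℝ, ℂ)) ξ * h ξ = ∫ x, φ x * 𝓕⁻ h x := by
  have key := VectorFourier.integral_fourierIntegral_smul_eq_flip (L := innerₗ ℝ)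
    (μ := volume) (ν := volume) (f := φ) (g := fun ξ => h (-ξ))
    Real.continuous_fourierChar continuous_inner φ.integrable hh.comp_neg
  rw [Real.fourierInv_eq_fourier_comp_neg h]
  have e1 : ∫ ξ, (𝓕⁻ φ : 𝓢(ℝ, ℂ)) ξ * h ξ = ∫ ξ, 𝓕 (φ : ℝ → ℂ) ξ * h (-ξ) := by
    rw [← integral_neg_eq_self]
    simp [SchwartzMap.fourierInv_coe, Real.fourierInv_eq_fourier_neg]
  rw [e1]
  simpa using! key

/-- A continuous function that defines the same tempered distribution as `𝓕⁻ h`, `h` integrable,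
is equal to `𝓕⁻ h` at every point. -/
lemma eq_fourierInv {h f : ℝ → ℂ} (hh : Integrable h) (hf : Continuous f)
    (H : ∀ φ : 𝓢(ℝ, ℂ), ∫ x, φ x * f x = ∫ ξ, (𝓕⁻ φ : 𝓢(ℝ, ℂ)) ξ * h ξ) :
    f = 𝓕⁻ h := by
  have hc : Continuous (𝓕⁻ h) := by
    have h1 : (𝓕⁻ h : ℝ → ℂ) = 𝓕 (fun x => h (-x)) := Real.fourierInv_eq_fourier_comp_neg h
    rw [h1]
    exact VectorFourier.fourierIntegral_continuous Real.continuous_fourierChar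
      (innerSL ℝ).continuous₂ hh.comp_neg
  refine (hf.ae_eq_iff_eq volume hc).1 ?_
  refine ae_eq_of_integral_contDiff_smul_eq hf.locallyIntegrable hc.locallyIntegrable
    fun g hg hgc => ?_
  have hg₁ : HasCompactSupport (Complex.ofRealCLM ∘ g) := hgc.comp_left rfl
  have hg₂ : ContDiff ℝ (⊤ : ℕ∞) (Complex.ofRealCLM ∘ g) := by fun_prop
  have := H (hg₁.toSchwartzMap hg₂)
  rw [integral_fourierInv_mul_eq hh] at this
  simpa using this

/-- A continuous function with Bessel potential `U` in `L²`, of order `s > 3/2`, is the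
absolutely convergent Fourier integral of its own Fourier transform. -/
lemma eq_fourierInv_of_besselPotential {s : ℝ} (hs : 3 / 2 < s) {f : ℝ → ℂ} (hfc : Continuous f)
    (hf : MemLp f 2 (volume : Measure ℝ)) {U : Lp ℂ 2 (volume : Measure ℝ)}
    (h : besselPotential ℝ ℂ s ((hf.toLp f : Lp ℂ 2 (volume : Measure ℝ)) : 𝓢'(ℝ, ℂ)) =
      (U : 𝓢'(ℝ, ℂ))) :
    f = 𝓕⁻ (fun ξ : ℝ => (((1 + ξ ^ 2) ^ (-s / 2) : ℝ) : ℂ) * (𝓕 U : Lp ℂ 2 volume) ξ) := by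
  have hm : MemLp (fun ξ : ℝ => (((1 + ‖ξ‖ ^ 2) ^ (-s / 2) : ℝ) : ℂ)) 2 := by
    simpa using (memLp_two_japanese (r := s) (by linarith)).ofReal (K := ℂ)
  have hd := (besselPotential_neg_apply_eq_iff s (U : 𝓢'(ℝ, ℂ))
    ((hf.toLp f : Lp ℂ 2 (volume : Measure ℝ)) : 𝓢'(ℝ, ℂ))).2 h
  rw [besselPotential, TemperedDistribution.fourierMultiplierCLM_apply,
    Lp.fourier_toTemperedDistribution_eq, ← Lp.toTemperedDistribution_smul_eq
      (r := 1) (by fun_prop) hm] at hd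
  have hint : Integrable (fun ξ : ℝ =>
      (((1 + ξ ^ 2) ^ (-s / 2) : ℝ) : ℂ) * (𝓕 U : Lp ℂ 2 volume) ξ) := by
    simpa using! hm.integrable_mul (Lp.memLp (𝓕 U : Lp ℂ 2 volume))
  refine eq_fourierInv hint hfc fun φ => ?_
  have := congrArg (fun D : 𝓢'(ℝ, ℂ) => D φ) hd
  simp only [TemperedDistribution.fourierInv_apply, Lp.toTemperedDistribution_apply,
    smul_eq_mul] at this
  have e : ∫ x, φ x * (hf.toLp f : Lp ℂ 2 volume) x = ∫ x, φ x * f x :=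
    integral_congr_ae (by filter_upwards [hf.coeFn_toLp] with x hx; rw [hx])
  rw [← e, ← this]
  refine integral_congr_ae ?_
  filter_upwards [Lp.coeFn_lpSMul (r := 1) (hm.toLp _) (𝓕 U : Lp ℂ 2 volume), hm.coeFn_toLp]
    with x h1 h2
  rw [h1, Pi.smul_apply', h2]
  simp

/-- Cauchy--Schwarz inequality. -/
lemma integral_norm_mul_le {m : ℝ → ℂ} (hm : MemLp m 2 (volume : Measure ℝ))
    (V : Lp ℂ 2 (volume : Measure ℝ)) :
    ∫ ξ, ‖m ξ * V ξ‖ ≤ (eLpNorm m 2 volume).toReal * ‖V‖ := by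
  rw [integral_norm_eq_lintegral_enorm (f := fun ξ => m ξ * V ξ)
    (hm.1.mul (Lp.aestronglyMeasurable V)), Lp.norm_def,
    ← ENNReal.toReal_mul, ← eLpNorm_one_eq_lintegral_enorm]
  refine ENNReal.toReal_mono (ENNReal.mul_ne_top hm.eLpNorm_ne_top (Lp.eLpNorm_ne_top V)) ?_
  have := eLpNorm_smul_le_mul_eLpNorm (p := 2) (q := 2) (r := 1) (f := (V : ℝ → ℂ)) (φ := m)
    (Lp.aestronglyMeasurable V) hm.1
  exact this

/-- The embedding `H^s ⊂ C¹` for `s > 3/2`: both `𝓕 f` and `ξ ↦ ξ 𝓕 f(ξ)` are products of two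
`L²` functions, hence integrable. -/
theorem sobolev_embedding {s : ℝ} (hs : 3 / 2 < s) :
    ∃ C : ℝ, 0 ≤ C ∧ ∀ f : ℝ → ℝ, Continuous f → ∀ hf : MemLp (cplx f) 2 (volume : Measure ℝ),
      ∀ U : Lp ℂ 2 (volume : Measure ℝ),
      besselPotential ℝ ℂ s
        ((hf.toLp (cplx f) : Lp ℂ 2 (volume : Measure ℝ)) : 𝓢'(ℝ, ℂ)) = (U : 𝓢'(ℝ, ℂ)) →
      Differentiable ℝ f ∧ Continuous (deriv f) ∧ (∀ x, |f x| ≤ C * ‖U‖) ∧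
        ∀ x, |deriv f x| ≤ C * ‖U‖ := by
  have hm : MemLp (fun ξ : ℝ => (((1 + ξ ^ 2) ^ (-s / 2) : ℝ) : ℂ)) 2 :=
    (memLp_two_japanese (r := s) (by linarith)).ofReal (K := ℂ)
  have hm' : MemLp (fun ξ : ℝ => ((ξ * (1 + ξ ^ 2) ^ (-s / 2) : ℝ) : ℂ)) 2 :=
    (memLp_two_id_mul_japanese hs).ofReal (K := ℂ)
  set c₀ := (eLpNorm (fun ξ : ℝ => (((1 + ξ ^ 2) ^ (-s / 2) : ℝ) : ℂ)) 2 volume).toReal with hc₀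
  set c₁ := (eLpNorm (fun ξ : ℝ => ((ξ * (1 + ξ ^ 2) ^ (-s / 2) : ℝ) : ℂ)) 2 volume).toReal with hc₁
  have h0 : 0 ≤ c₀ := ENNReal.toReal_nonneg
  have h1 : 0 ≤ c₁ := ENNReal.toReal_nonneg
  refine ⟨c₀ + 2 * Real.pi * c₁, by positivity, fun f hfc hf U hU => ?_⟩
  have hrep : cplx f = _ := eq_fourierInv_of_besselPotential hs
    (Complex.continuous_ofReal.comp hfc : Continuous (cplx f)) hf hU
  set V : Lp ℂ 2 (volume : Measure ℝ) := 𝓕 U with hV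
  have hVU : ‖V‖ = ‖U‖ := Lp.norm_fourier_eq U
  set h : ℝ → ℂ := fun ξ => (((1 + ξ ^ 2) ^ (-s / 2) : ℝ) : ℂ) * V ξ with hh
  have hint : Integrable h := hm.integrable_mul (Lp.memLp V)
  have hint' : Integrable (fun ξ : ℝ => ξ • h ξ) := by
    refine (hm'.integrable_mul (Lp.memLp V)).congr (ae_of_all _ fun ξ => ?_)
    simp [hh, mul_assoc]
  have hb0 : ∫ ξ, ‖h ξ‖ ≤ c₀ * ‖U‖ := hVU ▸ integral_norm_mul_le hm V
  have hb1 : ∫ ξ : ℝ, ‖ξ • h ξ‖ ≤ c₁ * ‖U‖ := by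
    have := integral_norm_mul_le hm' V
    rw [hVU] at this
    refine le_of_eq_of_le (integral_congr_ae (ae_of_all _ fun ξ => ?_)) this
    simp [hh, mul_assoc]
  set k : ℝ → ℂ := fun ξ => (-2 * Real.pi * Complex.I * ξ) • h ξ with hk
  have hkint : Integrable k := by
    refine (hint'.const_mul (-2 * Real.pi * Complex.I)).congr (ae_of_all _ fun ξ => ?_)
    simp [hk, mul_assoc]
  have hkn : ∫ ξ, ‖k ξ‖ = 2 * Real.pi * ∫ ξ : ℝ, ‖ξ • h ξ‖ := by
    rw [← integral_const_mul]
    refine integral_congr_ae (ae_of_all _ fun ξ => ?_)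
    simp [hk, abs_of_pos Real.pi_pos, mul_assoc]
  have hval : ∀ x, cplx f x = 𝓕 h (-x) := fun x => by
    rw [congrFun hrep x]; exact Real.fourierInv_eq_fourier_neg h x
  have hder : ∀ x, HasDerivAt (cplx f) (-(𝓕 k (-x))) x := fun x => by
    have := (Real.hasDerivAt_fourier hint hint' (-x)).scomp x (hasDerivAt_neg x)
    rw [show cplx f = 𝓕 h ∘ Neg.neg from funext hval]
    simpa only [neg_smul, one_smul] using this
  have hder' : ∀ x, HasDerivAt f (-(𝓕 k (-x))).re x := fun x =>
    (Complex.reCLM.hasFDerivAt.comp_hasDerivAt x (hder x)).congr_of_eventuallyEq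
      (Eventually.of_forall fun y => by simp [cplx])
  have hderiv : deriv f = fun x => (-(𝓕 k (-x))).re := funext fun x => (hder' x).deriv
  have hkc : Continuous (𝓕 k) := VectorFourier.fourierIntegral_continuous
    Real.continuous_fourierChar (innerSL ℝ).continuous₂ hkint
  refine ⟨fun x => (hder' x).differentiableAt, ?_, fun x => ?_, fun x => ?_⟩
  · rw [hderiv]
    exact Complex.continuous_re.comp (hkc.comp continuous_neg).neg
  · have e : |f x| = ‖𝓕 h (-x)‖ := by rw [← hval]; simp [cplx]
    have e2 : ‖𝓕 h (-x)‖ ≤ ∫ ξ, ‖h ξ‖ := VectorFourier.norm_fourierIntegral_le_integral_norm ..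
    have : 0 ≤ 2 * Real.pi * c₁ * ‖U‖ := by positivity
    linarith
  · have e : |deriv f x| ≤ ‖𝓕 k (-x)‖ := by
      rw [hderiv, ← norm_neg (𝓕 k (-x))]
      exact Complex.abs_re_le_norm _
    have e2 : ‖𝓕 k (-x)‖ ≤ ∫ ξ, ‖k ξ‖ := VectorFourier.norm_fourierIntegral_le_integral_norm ..
    have e3 : 2 * Real.pi * ∫ ξ : ℝ, ‖ξ • h ξ‖ ≤ 2 * Real.pi * (c₁ * ‖U‖) := by gcongr
    have : 0 ≤ c₀ * ‖U‖ := by positivity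
    linarith

/-- A curve `a` of functions on the line that is bounded by `M` in `C¹`, with the continuity in
time that the analysis along characteristics needs. -/
structure BddC1 (T M : ℝ) (a : ℝ → ℝ → ℝ) : Prop where
  diff : ∀ t ∈ Icc (0 : ℝ) T, Differentiable ℝ (a t)
  abs_le : ∀ t ∈ Icc (0 : ℝ) T, ∀ x, |a t x| ≤ M
  abs_deriv_le : ∀ t ∈ Icc (0 : ℝ) T, ∀ x, |deriv (a t) x| ≤ M
  cont_time : ∀ x, ContinuousOn (fun t => a t x) (Icc 0 T)
  cont_deriv : ContinuousOn (fun p : ℝ × ℝ => deriv (a p.1) p.2) (Icc 0 T ×ˢ univ)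

lemma BddC1.mono {T M M' : ℝ} {a : ℝ → ℝ → ℝ} (h : BddC1 T M a) (hM : M ≤ M') :
    BddC1 T M' a :=
  ⟨h.diff, fun t ht x => (h.abs_le t ht x).trans hM,
    fun t ht x => (h.abs_deriv_le t ht x).trans hM, h.cont_time, h.cont_deriv⟩

/-- A continuous curve in `H^s`, `s > 3/2`, is bounded in `C¹`: the embedding is applied to its
values and, by linearity, to the difference of two values. -/
theorem ContinuousInHs.exists_bddC1 {s T : ℝ} (hs : 3 / 2 < s) {u : ℝ → ℝ → ℝ}
    (hu : ContinuousInHs s T u) (huc : ∀ t ∈ Icc (0 : ℝ) T, Continuous (u t)) :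
    ∃ M, BddC1 T M u := by
  obtain ⟨C, hC, hemb⟩ := sobolev_embedding hs
  obtain ⟨U, hUc, hU⟩ := hu
  have hC1 : ∀ t ∈ Icc (0 : ℝ) T, Differentiable ℝ (u t) ∧ Continuous (deriv (u t)) ∧
      (∀ x, |u t x| ≤ C * ‖U t‖) ∧ ∀ x, |deriv (u t) x| ≤ C * ‖U t‖ := fun t ht => by
    obtain ⟨hf, hb⟩ := hU t ht
    exact hemb _ (huc t ht) hf (U t) hb
  have hdiff : ∀ t ∈ Icc (0 : ℝ) T, ∀ r ∈ Icc (0 : ℝ) T,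
      (∀ x, |u t x - u r x| ≤ C * ‖U t - U r‖) ∧
        ∀ x, |deriv (u t) x - deriv (u r) x| ≤ C * ‖U t - U r‖ := fun t ht r hr => by
    obtain ⟨hf, hb⟩ := hU t ht
    obtain ⟨hg, hc⟩ := hU r hr
    have hsub : cplx (fun x => u t x - u r x) = cplx (u t) - cplx (u r) := by
      ext x; simp [cplx]
    have hfg : MemLp (cplx (fun x => u t x - u r x)) 2 (volume : Measure ℝ) := by
      rw [hsub]; exact hf.sub hg
    have e : hfg.toLp _ = hf.toLp _ - hg.toLp _ := by
      rw [← MemLp.toLp_sub]; exact MemLp.toLp_congr _ _ (by rw [hsub])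
    have := hemb (fun x => u t x - u r x) ((huc t ht).sub (huc r hr)) hfg (U t - U r) (by
      rw [e, ← Lp.toTemperedDistributionCLM_apply, ← Lp.toTemperedDistributionCLM_apply,
        map_sub, map_sub, map_sub]
      simp only [Lp.toTemperedDistributionCLM_apply]
      rw [hb, hc])
    refine ⟨this.2.2.1, fun x => ?_⟩
    have h2 := this.2.2.2 x
    rwa [deriv_fun_sub ((hC1 t ht).1 x) ((hC1 r hr).1 x)] at h2
  obtain ⟨R, hR⟩ := isCompact_Icc.exists_bound_of_continuousOn hUc
  refine ⟨C * R, fun t ht => (hC1 t ht).1,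
    fun t ht x => ((hC1 t ht).2.2.1 x).trans (mul_le_mul_of_nonneg_left (hR t ht) hC),
    fun t ht x => ((hC1 t ht).2.2.2 x).trans (mul_le_mul_of_nonneg_left (hR t ht) hC),
    fun x t ht => ?_, fun p hp => ?_⟩
  · have h0 : Tendsto (fun r => C * ‖U r - U t‖) (𝓝[Icc 0 T] t) (𝓝 0) := by
      have := ((hUc t ht).sub_const (U t)).norm.const_mul C
      simpa using this
    rw [ContinuousWithinAt, tendsto_iff_norm_sub_tendsto_zero]
    refine squeeze_zero' (Eventually.of_forall fun _ => norm_nonneg _) ?_ h0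
    filter_upwards [self_mem_nhdsWithin] with r hr using (hdiff r hr t ht).1 x
  · have h0 : Tendsto (fun q : ℝ × ℝ => C * ‖U q.1 - U p.1‖ +
        ‖deriv (u p.1) q.2 - deriv (u p.1) p.2‖) (𝓝[Icc 0 T ×ˢ univ] p) (𝓝 0) := by
      have h1 : Tendsto (fun q : ℝ × ℝ => q.1) (𝓝[Icc 0 T ×ˢ univ] p) (𝓝[Icc 0 T] p.1) :=
        continuous_fst.continuousWithinAt.tendsto_nhdsWithin fun q hq => hq.1
      have h2 : Tendsto (fun r => C * ‖U r - U p.1‖) (𝓝[Icc 0 T] p.1) (𝓝 0) := by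
        have := ((hUc p.1 hp.1).sub_const (U p.1)).norm.const_mul C
        simpa using this
      have h3 : Continuous (fun q : ℝ × ℝ => ‖deriv (u p.1) q.2 - deriv (u p.1) p.2‖) :=
        (((hC1 p.1 hp.1).2.1.comp continuous_snd).sub continuous_const).norm
      have h4 := (h3.tendsto p).mono_left (nhdsWithin_le_nhds (s := Icc (0 : ℝ) T ×ˢ univ))
      simpa using (h2.comp h1).add h4
    rw [ContinuousWithinAt, tendsto_iff_norm_sub_tendsto_zero]
    refine squeeze_zero' (Eventually.of_forall fun _ => norm_nonneg _) ?_ h0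
    filter_upwards [self_mem_nhdsWithin] with q hq
    calc ‖deriv (u q.1) q.2 - deriv (u p.1) p.2‖
        = ‖(deriv (u q.1) q.2 - deriv (u p.1) q.2)
            + (deriv (u p.1) q.2 - deriv (u p.1) p.2)‖ := by congr 1; ring
      _ ≤ _ := (norm_add_le _ _).trans
          (add_le_add_left ((hdiff q.1 hq.1 p.1 hp.1).2 q.2) _)

/-! ### Weighted estimates for convolution with `G` and `∂ₓG` -/

/-- `ψ` is positive and changes by a factor of at most `e^{α|x-y|}` between `x` and `y`. -/
structure IsExpWeight (α : ℝ) (ψ : ℝ → ℝ) : Prop where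
  pos : ∀ x, 0 < ψ x
  le : ∀ x y, ψ y ≤ Real.exp (α * |x - y|) * ψ x

/-- `|a|` and `|aₓ|` are bounded by `S ψ`. -/
def C1Le (S : ℝ) (ψ a : ℝ → ℝ) : Prop :=
  ∀ x, |a x| ≤ S * ψ x ∧ |deriv a x| ≤ S * ψ x

/-- The two properties of `G` and `∂ₓG` that matter: a kernel of size `e^{-|z|} / 2`, Lipschitz up
to a jump of size at most `1` at the origin. -/
structure IsGreenKernel (k : ℝ → ℝ) : Prop where
  meas : Measurable k
  abs_le : ∀ z, |k z| ≤ (1 / 2) * Real.exp (-|z|)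
  abs_sub_le : ∀ z d, |k (z + d) - k z| ≤
    (1 / 2) * |d| * Real.exp |d| * Real.exp (-|z|) + (Icc (-|d|) |d|).indicator 1 z

lemma abs_exp_sub_one_le_mul {r d : ℝ} (h : |r| ≤ d) : |Real.exp r - 1| ≤ d * Real.exp d := by
  obtain ⟨h1, h2⟩ := abs_le.1 h
  have hd : 0 ≤ d := (abs_nonneg r).trans h
  have h3 := Real.add_one_le_exp r
  have h4 := Real.add_one_le_exp (-d)
  have h5 : Real.exp (-d) * Real.exp d = 1 := by rw [← Real.exp_add]; simp
  have h6 : Real.exp r ≤ Real.exp d := Real.exp_le_exp.2 h2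
  have h7 : 1 ≤ Real.exp d := Real.one_le_exp hd
  rw [abs_le]
  constructor <;> nlinarith [Real.exp_pos d]

lemma abs_green (z : ℝ) : |green z| = (1 / 2) * Real.exp (-|z|) :=
  abs_of_nonneg (by unfold green; positivity)

lemma abs_green_sub_le (z d : ℝ) :
    |green (z + d) - green z| ≤ (1 / 2) * |d| * Real.exp |d| * Real.exp (-|z|) := by
  have h : |(|z| - |z + d|)| ≤ |d| := by
    have := abs_abs_sub_abs_le z (z + d)
    simpa using this
  have e : green (z + d) - green z
      = (1 / 2) * Real.exp (-|z|) * (Real.exp (|z| - |z + d|) - 1) := by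
    have : Real.exp (-|z + d|) = Real.exp (-|z|) * Real.exp (|z| - |z + d|) := by
      rw [← Real.exp_add]; congr 1; ring
    unfold green; rw [this]; ring
  rw [e, abs_mul, abs_of_nonneg (by positivity : 0 ≤ (1 / 2) * Real.exp (-|z|))]
  have := mul_le_mul_of_nonneg_left (abs_exp_sub_one_le_mul h)
    (by positivity : 0 ≤ (1 / 2) * Real.exp (-|z|))
  linarith

lemma isGreenKernel_green : IsGreenKernel green where
  meas := by unfold green; fun_prop
  abs_le z := (abs_green z).le
  abs_sub_le z d := (abs_green_sub_le z d).trans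
    (le_add_of_nonneg_right (indicator_nonneg (fun _ _ => zero_le_one) z))

lemma deriv_green_of_pos {z : ℝ} (hz : 0 < z) : deriv green z = -green z := by
  have h : HasDerivAt (fun y : ℝ => (1 / 2) * Real.exp (-y)) ((1 / 2) * (Real.exp (-z) * -1)) z :=
    ((hasDerivAt_neg z).exp).const_mul _
  have e : green =ᶠ[𝓝 z] fun y : ℝ => (1 / 2) * Real.exp (-y) := by
    filter_upwards [lt_mem_nhds hz] with y hy
    rw [green, abs_of_pos hy]
  rw [e.deriv_eq, h.deriv, green, abs_of_pos hz]; ring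

lemma deriv_green_of_neg {z : ℝ} (hz : z < 0) : deriv green z = green z := by
  have h : HasDerivAt (fun y : ℝ => (1 / 2) * Real.exp y) ((1 / 2) * Real.exp z) z :=
    (Real.hasDerivAt_exp z).const_mul _
  have e : green =ᶠ[𝓝 z] fun y : ℝ => (1 / 2) * Real.exp y := by
    filter_upwards [gt_mem_nhds hz] with y hy
    rw [green, abs_of_neg hy, neg_neg]
  rw [e.deriv_eq, h.deriv, green, abs_of_neg hz, neg_neg]

/-- At the corner of `G` the junk value of `deriv` is `0`. -/
lemma deriv_green_zero : deriv green 0 = 0 := by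
  refine IsLocalMax.deriv_eq_zero (Eventually.of_forall fun y => ?_)
  have : Real.exp (-|y|) ≤ 1 := Real.exp_le_one_iff.2 (by simp)
  simp only [green, abs_zero, neg_zero, Real.exp_zero]
  linarith

lemma abs_deriv_green_le (z : ℝ) : |deriv green z| ≤ (1 / 2) * Real.exp (-|z|) := by
  rcases lt_trichotomy z 0 with h | h | h
  · rw [deriv_green_of_neg h, abs_green]
  · rw [h, deriv_green_zero, abs_zero]; positivity
  · rw [deriv_green_of_pos h, abs_neg, abs_green]

lemma isGreenKernel_deriv_green : IsGreenKernel (deriv green) where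
  meas := measurable_deriv _
  abs_le := abs_deriv_green_le
  abs_sub_le z d := by
    have hnn : 0 ≤ (Icc (-|d|) |d|).indicator (1 : ℝ → ℝ) z :=
      indicator_nonneg (fun _ _ => zero_le_one) z
    by_cases hz : z ∈ Icc (-|d|) |d|
    · -- `z` and `z + d` may lie on different sides of the jump
      have h1 : |deriv green (z + d)| ≤ 1 / 2 := (abs_deriv_green_le _).trans
        (by have : Real.exp (-|z + d|) ≤ 1 := Real.exp_le_one_iff.2 (by simp)
            linarith)
      have h2 : |deriv green z| ≤ 1 / 2 := (abs_deriv_green_le _).trans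
        (by have : Real.exp (-|z|) ≤ 1 := Real.exp_le_one_iff.2 (by simp)
            linarith)
      rw [indicator_of_mem hz, Pi.one_apply]
      have h3 := abs_sub (deriv green (z + d)) (deriv green z)
      have h4 : 0 ≤ (1 / 2) * |d| * Real.exp |d| * Real.exp (-|z|) := by positivity
      linarith
    · refine le_add_of_le_of_nonneg ?_ hnn
      have hd := neg_abs_le d
      have hd' := le_abs_self d
      rw [mem_Icc, not_and_or, not_le, not_le] at hz
      rcases hz with hz | hz
      · rw [deriv_green_of_neg (by linarith : z + d < 0),
          deriv_green_of_neg (by linarith [abs_nonneg d] : z < 0)]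
        exact abs_green_sub_le z d
      · rw [deriv_green_of_pos (by linarith : 0 < z + d),
          deriv_green_of_pos (by linarith [abs_nonneg d] : 0 < z), neg_sub_neg, abs_sub_comm]
        exact abs_green_sub_le z d

lemma integrable_exp_neg_mul_abs {β : ℝ} (hβ : 0 < β) :
    Integrable fun z : ℝ => Real.exp (-β * |z|) := by
  rw [← integrableOn_univ, ← Iic_union_Ioi (a := (0 : ℝ))]
  refine IntegrableOn.union ?_ ?_
  · refine (integrableOn_exp_mul_Iic hβ 0).congr_fun (fun z hz => ?_) measurableSet_Iic
    simp only [abs_of_nonpos (mem_Iic.1 hz)]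
    congr 1; ring
  · refine (integrableOn_exp_mul_Ioi (neg_neg_of_pos hβ) 0).congr_fun (fun z hz => ?_)
      measurableSet_Ioi
    simp only [abs_of_pos (mem_Ioi.1 hz)]

lemma conv_eq (k p : ℝ → ℝ) (x : ℝ) : conv k p x = ∫ t, k (x - t) * p t :=
  convolution_mul_swap

/-- Against a weight of exponential rate `α < 1`, the Green kernel reproduces the weight. -/
lemma green_mul_weight_le {α Q x t : ℝ} {k p ψ : ℝ → ℝ} (hk : IsGreenKernel k)
    (hψ : IsExpWeight α ψ) (hQ : 0 ≤ Q) (hp : ∀ y, |p y| ≤ Q * ψ y) :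
    |k (x - t) * p t| ≤ (1 / 2) * Q * ψ x * Real.exp (-(1 - α) * |x - t|) := by
  have e : Real.exp (-(1 - α) * |x - t|) = Real.exp (-|x - t|) * Real.exp (α * |x - t|) := by
    rw [← Real.exp_add]; congr 1; ring
  calc |k (x - t) * p t| = |k (x - t)| * |p t| := abs_mul _ _
    _ ≤ ((1 / 2) * Real.exp (-|x - t|)) * (Q * (Real.exp (α * |x - t|) * ψ x)) := by
        gcongr
        · exact hk.abs_le _
        · exact (hp t).trans (mul_le_mul_of_nonneg_left (hψ.le x t) hQ)
    _ = _ := by rw [e]; ring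

lemma integrable_green_mul {α Q : ℝ} (hα : α < 1) {k p ψ : ℝ → ℝ} (hk : IsGreenKernel k)
    (hψ : IsExpWeight α ψ) (hQ : 0 ≤ Q) (hpm : Measurable p) (hp : ∀ y, |p y| ≤ Q * ψ y) (x : ℝ) :
    Integrable fun t => k (x - t) * p t := by
  have hg : Integrable fun t : ℝ => (1 / 2) * Q * ψ x * Real.exp (-(1 - α) * |x - t|) :=
    ((integrable_exp_neg_mul_abs (by linarith : 0 < 1 - α)).comp_sub_left x).const_mul _
  refine hg.mono' ?_ (ae_of_all _ fun t => green_mul_weight_le hk hψ hQ hp)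
  exact ((hk.meas.comp (by fun_prop)).mul hpm).aestronglyMeasurable

lemma abs_conv_le {α Q : ℝ} (hα : α < 1) {k p ψ : ℝ → ℝ} (hk : IsGreenKernel k)
    (hψ : IsExpWeight α ψ) (hQ : 0 ≤ Q) (hp : ∀ y, |p y| ≤ Q * ψ y) (x : ℝ) :
    |conv k p x| ≤ (1 / 2) * (∫ z : ℝ, Real.exp (-(1 - α) * |z|)) * Q * ψ x := by
  have hg : Integrable fun t : ℝ => (1 / 2) * Q * ψ x * Real.exp (-(1 - α) * |x - t|) :=
    ((integrable_exp_neg_mul_abs (by linarith : 0 < 1 - α)).comp_sub_left x).const_mul _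
  rw [conv_eq]
  have hb : ∀ t, ‖k (x - t) * p t‖ ≤ (1 / 2) * Q * ψ x * Real.exp (-(1 - α) * |x - t|) :=
    fun t => green_mul_weight_le hk hψ hQ hp
  refine (norm_integral_le_of_norm_le hg (ae_of_all _ hb)).trans (le_of_eq ?_)
  rw [integral_const_mul, integral_sub_left_eq_self (fun z : ℝ => Real.exp (-(1 - α) * |z|))]
  ring

/-- The weighted Lipschitz estimate. The jump of the kernel is integrated over an interval of length
`2|d|`, so that it also contributes a multiple of `|d|`. -/
lemma abs_conv_sub_le {α Q D : ℝ} (hα : α < 1) {k p ψ : ℝ → ℝ}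
    (hk : IsGreenKernel k) (hψ : IsExpWeight α ψ) (hQ : 0 ≤ Q) (hpm : Measurable p)
    (hp : ∀ y, |p y| ≤ Q * ψ y) (x : ℝ) {d : ℝ} (hd : |d| ≤ D) :
    |conv k p (x + d) - conv k p x| ≤
      ((1 / 2) * Real.exp D * (∫ z : ℝ, Real.exp (-(1 - α) * |z|)) + 2 * Real.exp D) *
        Q * ψ x * |d| := by
  set I := ∫ z : ℝ, Real.exp (-(1 - α) * |z|) with hI
  have hI0 : 0 ≤ I := integral_nonneg fun z => (Real.exp_pos _).le
  have hψx := (hψ.pos x).le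
  set F : ℝ → ℝ := fun z => (1 / 2) * |d| * Real.exp |d| * Q * ψ x * Real.exp (-(1 - α) * |z|)
    + (Icc (-|d|) |d|).indicator (fun _ => Q * ψ x * Real.exp |d|) z with hF
  have hF1 : Integrable fun z : ℝ =>
      (1 / 2) * |d| * Real.exp |d| * Q * ψ x * Real.exp (-(1 - α) * |z|) :=
    (integrable_exp_neg_mul_abs (by linarith : 0 < 1 - α)).const_mul _
  have hF2 : Integrable ((Icc (-|d|) |d|).indicator (fun _ : ℝ => Q * ψ x * Real.exp |d|)) :=
    (integrable_indicator_iff measurableSet_Icc).2 (integrableOn_const (by simp))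
  have hFint : ∫ z, F z = (1 / 2) * |d| * Real.exp |d| * Q * ψ x * I
      + 2 * |d| * (Q * ψ x * Real.exp |d|) := by
    rw [hF, integral_add hF1 hF2, integral_const_mul, integral_indicator measurableSet_Icc,
      setIntegral_const, Real.volume_real_Icc_of_le (neg_le_self (abs_nonneg d)), sub_neg_eq_add,
      ← two_mul, smul_eq_mul]
  have hbound : ∀ t, ‖k (x + d - t) * p t - k (x - t) * p t‖ ≤ F (x - t) := fun t => by
    have e : Real.exp (-(1 - α) * |x - t|) = Real.exp (-|x - t|) * Real.exp (α * |x - t|) := by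
      rw [← Real.exp_add]; congr 1; ring
    have h1 := hk.abs_sub_le (x - t) d
    have h2 : |p t| ≤ Q * (Real.exp (α * |x - t|) * ψ x) :=
      (hp t).trans (mul_le_mul_of_nonneg_left (hψ.le x t) hQ)
    have h3 : (Icc (-|d|) |d|).indicator (1 : ℝ → ℝ) (x - t) *
        (Q * (Real.exp (α * |x - t|) * ψ x)) ≤
        (Icc (-|d|) |d|).indicator (fun _ => Q * ψ x * Real.exp |d|) (x - t) := by
      by_cases hz : x - t ∈ Icc (-|d|) |d|
      · rw [indicator_of_mem hz, indicator_of_mem hz, Pi.one_apply, one_mul, mul_comm (Real.exp _),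
          ← mul_assoc]
        have : |x - t| ≤ |d| := abs_le.2 hz
        have : α * |x - t| ≤ |d| := by nlinarith [abs_nonneg (x - t)]
        gcongr
      · rw [indicator_of_notMem hz, indicator_of_notMem hz, zero_mul]
    calc ‖k (x + d - t) * p t - k (x - t) * p t‖
        = |k (x - t + d) - k (x - t)| * |p t| := by
          rw [← sub_mul, Real.norm_eq_abs, abs_mul]; congr 4; ring
      _ ≤ ((1 / 2) * |d| * Real.exp |d| * Real.exp (-|x - t|)
            + (Icc (-|d|) |d|).indicator 1 (x - t)) * (Q * (Real.exp (α * |x - t|) * ψ x)) :=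
          mul_le_mul h1 h2 (abs_nonneg _) ((abs_nonneg _).trans h1)
      _ ≤ F (x - t) := by
          rw [add_mul, hF]
          refine add_le_add (le_of_eq ?_) h3
          rw [e]; ring
  rw [conv_eq, conv_eq, ← integral_sub (integrable_green_mul hα hk hψ hQ hpm hp _)
    (integrable_green_mul hα hk hψ hQ hpm hp _)]
  refine (norm_integral_le_of_norm_le ((hF1.add hF2).comp_sub_left x)
    (ae_of_all _ hbound)).trans ?_
  change ∫ t, F (x - t) ≤ _
  rw [integral_sub_left_eq_self F, hFint]
  have h1 : (1 / 2) * |d| * Real.exp |d| * Q * ψ x * I ≤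
      (1 / 2) * |d| * Real.exp D * Q * ψ x * I := by gcongr
  have h2 : 2 * |d| * (Q * ψ x * Real.exp |d|) ≤ 2 * |d| * (Q * ψ x * Real.exp D) := by gcongr
  linarith

/-- The part of the evolution equation for `a` left over when the transport term
`(a + b + c) aₓ` is removed. -/
def nonlocalPart (a b c : ℝ → ℝ) (x : ℝ) : ℝ :=
  conv green (fun y => a y * deriv b y + a y * deriv c y) x + conv (deriv green) (quad a b c) x

/-- In each quadratic term one factor is bounded by `M` and the other by `S ψ`. -/
lemma abs_quad_le {M S : ℝ} {a b c ψ : ℝ → ℝ} (ha : C1Le M 1 a) (hb : C1Le M 1 b)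
    (hc : C1Le M 1 c) (ha' : C1Le S ψ a) (hb' : C1Le S ψ b) (hc' : C1Le S ψ c) (x : ℝ) :
    |quad a b c x| ≤ 6 * M * S * ψ x := by
  have key : ∀ {p q : ℝ}, |p| ≤ M * 1 → |q| ≤ S * ψ x → |p * q| ≤ M * (S * ψ x) :=
    fun {p q} hp hq => by
      rw [abs_mul]
      rw [mul_one] at hp
      exact mul_le_mul hp hq (abs_nonneg _) ((abs_nonneg _).trans hp)
  have h1 := abs_le.1 (key (ha x).1 (ha' x).1)
  have h2 := abs_le.1 (key (ha x).2 (ha' x).2)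
  have h3 := abs_le.1 (key (ha x).2 (hb' x).2)
  have h4 := abs_le.1 (key (ha x).2 (hc' x).2)
  have h5 := abs_le.1 (key (hb x).1 (hb' x).1)
  have h6 := abs_le.1 (key (hb x).2 (hb' x).2)
  have h7 := abs_le.1 (key (hc x).1 (hc' x).1)
  have h8 := abs_le.1 (key (hc x).2 (hc' x).2)
  unfold quad
  rw [abs_le]
  constructor <;> nlinarith

lemma abs_mul_deriv_add_le {M S : ℝ} {a b c ψ : ℝ → ℝ} (ha : C1Le M 1 a)
    (hb' : C1Le S ψ b) (hc' : C1Le S ψ c) (x : ℝ) :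
    |a x * deriv b x + a x * deriv c x| ≤ 2 * M * S * ψ x := by
  have ha1 : |a x| ≤ M := by simpa using (ha x).1
  have key : ∀ {q : ℝ}, |q| ≤ S * ψ x → |a x * q| ≤ M * (S * ψ x) := fun {q} hq => by
    rw [abs_mul]
    exact mul_le_mul ha1 hq (abs_nonneg _) ((abs_nonneg _).trans ha1)
  have h1 := abs_le.1 (key (hb' x).2)
  have h2 := abs_le.1 (key (hc' x).2)
  rw [abs_le]
  constructor <;> nlinarith

lemma measurable_quad {a b c : ℝ → ℝ} (ha : Differentiable ℝ a) (hb : Differentiable ℝ b)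
    (hc : Differentiable ℝ c) : Measurable (quad a b c) := by
  have h1 := ha.continuous.measurable
  have h2 := hb.continuous.measurable
  have h3 := hc.continuous.measurable
  have h4 := measurable_deriv a
  have h5 := measurable_deriv b
  have h6 := measurable_deriv c
  unfold quad
  fun_prop

/-- The nonlocal part of the equation inherits a weighted bound, and so do its difference
quotients: this takes the place of a bound on its `x`-derivative. -/
lemma nonlocalPart_bounds {α M D : ℝ} (hα : α < 1) (hM : 0 ≤ M) :
    ∃ κ : ℝ, 0 ≤ κ ∧ ∀ (ψ a b c : ℝ → ℝ) (S : ℝ), IsExpWeight α ψ → 0 ≤ S →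
      Differentiable ℝ a → Differentiable ℝ b → Differentiable ℝ c →
      C1Le M 1 a → C1Le M 1 b → C1Le M 1 c → C1Le S ψ a → C1Le S ψ b → C1Le S ψ c →
      ∀ x, |nonlocalPart a b c x| ≤ κ * S * ψ x ∧
        ∀ d, |d| ≤ D → |nonlocalPart a b c (x + d) - nonlocalPart a b c x| ≤ κ * S * ψ x * |d| := by
  set I := ∫ z : ℝ, Real.exp (-(1 - α) * |z|) with hI
  have hI0 : 0 ≤ I := integral_nonneg fun z => (Real.exp_pos _).le
  set κ₀ := (1 / 2) * I with hκ₀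
  set κ₁ := (1 / 2) * Real.exp D * I + 2 * Real.exp D with hκ₁
  have h0 : 0 ≤ κ₀ := by positivity
  have h1 : 0 ≤ κ₁ := by positivity
  refine ⟨8 * M * (κ₀ + κ₁), by positivity,
    fun ψ a b c S hψ hS da db dc ha hb hc ha' hb' hc' x => ?_⟩
  have hp := abs_mul_deriv_add_le ha hb' hc'
  have hq := abs_quad_le ha hb hc ha' hb' hc'
  have hpm : Measurable fun y => a y * deriv b y + a y * deriv c y := by
    have h1 := da.continuous.measurable
    have h5 := measurable_deriv b
    have h6 := measurable_deriv c
    fun_prop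
  have hqm := measurable_quad da db dc
  have hψx := (hψ.pos x).le
  refine ⟨?_, fun d hd => ?_⟩
  · have e1 := abs_conv_le hα isGreenKernel_green hψ (by positivity) hp x
    have e2 := abs_conv_le hα isGreenKernel_deriv_green hψ (by positivity) hq x
    have e3 : 0 ≤ κ₁ * (8 * M * S * ψ x) := by positivity
    calc |nonlocalPart a b c x| ≤ _ := abs_add_le _ _
      _ ≤ κ₀ * (2 * M * S) * ψ x + κ₀ * (6 * M * S) * ψ x := add_le_add e1 e2
      _ ≤ _ := by linarith
  · have e1 := abs_conv_sub_le hα isGreenKernel_green hψ (by positivity) hpm hp x hd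
    have e2 := abs_conv_sub_le hα isGreenKernel_deriv_green hψ (by positivity) hqm hq x hd
    have e3 : 0 ≤ κ₀ * (8 * M * S * ψ x * |d|) := by positivity
    calc |nonlocalPart a b c (x + d) - nonlocalPart a b c x|
        = |(conv green (fun y => a y * deriv b y + a y * deriv c y) (x + d)
              - conv green (fun y => a y * deriv b y + a y * deriv c y) x)
            + (conv (deriv green) (quad a b c) (x + d) - conv (deriv green) (quad a b c) x)| := by
          unfold nonlocalPart; congr 1; ring
      _ ≤ _ := abs_add_le _ _
      _ ≤ κ₁ * (2 * M * S) * ψ x * |d| + κ₁ * (6 * M * S) * ψ x * |d| := add_le_add e1 e2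
      _ ≤ _ := by linarith

/-! ### Characteristics -/

lemma BddC1.add {T M N : ℝ} {a b : ℝ → ℝ → ℝ} (ha : BddC1 T M a) (hb : BddC1 T N b) :
    BddC1 T (M + N) (fun t x => a t x + b t x) := by
  have hd : ∀ t ∈ Icc (0 : ℝ) T, ∀ x,
      deriv (fun y => a t y + b t y) x = deriv (a t) x + deriv (b t) x :=
    fun t ht x => deriv_fun_add (ha.diff t ht x) (hb.diff t ht x)
  refine ⟨fun t ht => (ha.diff t ht).fun_add (hb.diff t ht),
    fun t ht x => (abs_add_le _ _).trans (add_le_add (ha.abs_le t ht x) (hb.abs_le t ht x)),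
    fun t ht x => ?_, fun x => (ha.cont_time x).add (hb.cont_time x), ?_⟩
  · rw [hd t ht x]
    exact (abs_add_le _ _).trans (add_le_add (ha.abs_deriv_le t ht x) (hb.abs_deriv_le t ht x))
  · exact (ha.cont_deriv.add hb.cont_deriv).congr fun p hp => hd p.1 hp.1 p.2

lemma BddC1.abs_sub_le {T M : ℝ} {a : ℝ → ℝ → ℝ} (ha : BddC1 T M a) {t : ℝ}
    (ht : t ∈ Icc (0 : ℝ) T) (x y : ℝ) : |a t x - a t y| ≤ M * |x - y| :=
  convex_univ.norm_image_sub_le_of_norm_deriv_le (fun z _ => ha.diff t ht z)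
    (fun z _ => ha.abs_deriv_le t ht z) (mem_univ y) (mem_univ x)

/-- `q` is a characteristic of the velocity field `V` on `[0,T]`. -/
def IsCharacteristic (T : ℝ) (V : ℝ → ℝ → ℝ) (q : ℝ → ℝ) : Prop :=
  ∀ t ∈ Icc (0 : ℝ) T, HasDerivWithinAt q (V t (q t)) (Icc 0 T) t

/-- Through every point passes a characteristic defined on all of `[0,T]`, since the velocity is
bounded and Lipschitz. -/
lemma BddC1.exists_characteristic {T N : ℝ} {V : ℝ → ℝ → ℝ} (hV : BddC1 T N V) {t₀ : ℝ}
    (ht₀ : t₀ ∈ Icc (0 : ℝ) T) (y : ℝ) : ∃ q : ℝ → ℝ, q t₀ = y ∧ IsCharacteristic T V q := by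
  have hN : 0 ≤ N := (abs_nonneg _).trans (hV.abs_le t₀ ht₀ 0)
  have hT : 0 ≤ T := ht₀.1.trans ht₀.2
  have hPL : IsPicardLindelof V (⟨t₀, ht₀⟩ : Icc (0 : ℝ) T) y
      ⟨N * T, mul_nonneg hN hT⟩ 0 ⟨N, hN⟩ ⟨N, hN⟩ := by
    refine ⟨fun t ht => ?_, fun x _ => hV.cont_time x, fun t ht x _ => hV.abs_le t ht x, ?_⟩
    · exact (LipschitzWith.of_dist_le_mul fun x z => hV.abs_sub_le ht x z).lipschitzOnWith
    · change N * max (T - t₀) (t₀ - 0) ≤ N * T - 0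
      rw [sub_zero, sub_zero]
      exact mul_le_mul_of_nonneg_left (max_le (by linarith [ht₀.1]) ht₀.2) hN
  exact hPL.exists_eq_forall_mem_Icc_hasDerivWithinAt₀

lemma IsCharacteristic.abs_sub_le {T N : ℝ} {V : ℝ → ℝ → ℝ} {q : ℝ → ℝ}
    (hq : IsCharacteristic T V q) (hV : BddC1 T N V) {t r : ℝ} (ht : t ∈ Icc (0 : ℝ) T)
    (hr : r ∈ Icc (0 : ℝ) T) : |q t - q r| ≤ N * T := by
  have hN : 0 ≤ N := (abs_nonneg _).trans (hV.abs_le t ht 0)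
  have h := (convex_Icc (0 : ℝ) T).norm_image_sub_le_of_norm_hasDerivWithin_le hq
    (fun τ hτ => hV.abs_le τ hτ _) hr ht
  refine h.trans (mul_le_mul_of_nonneg_left ?_ hN)
  rw [Real.norm_eq_abs, abs_le]
  constructor <;> linarith [ht.1, ht.2, hr.1, hr.2]

/-- Going backwards in time, two characteristics separate at most exponentially. The square of
their distance is used because nothing is assumed about its sign. -/
lemma IsCharacteristic.abs_sub_le_exp {T N : ℝ} {V : ℝ → ℝ → ℝ} {q₁ q₂ : ℝ → ℝ}
    (h₁ : IsCharacteristic T V q₁) (h₂ : IsCharacteristic T V q₂) (hV : BddC1 T N V) {r t : ℝ}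
    (hr : r ∈ Icc (0 : ℝ) T) (ht : t ∈ Icc (0 : ℝ) T) (hrt : r ≤ t) :
    |q₂ r - q₁ r| ≤ Real.exp (N * T) * |q₂ t - q₁ t| := by
  have hN : 0 ≤ N := (abs_nonneg _).trans (hV.abs_le t ht 0)
  set E : ℝ → ℝ := fun τ => (Real.exp (N * τ) * (q₂ τ - q₁ τ)) ^ 2 with hE
  have hder : ∀ τ ∈ Icc (0 : ℝ) T, HasDerivWithinAt E
      (2 * Real.exp (N * τ) ^ 2 * (N * (q₂ τ - q₁ τ) ^ 2
        + (q₂ τ - q₁ τ) * (V τ (q₂ τ) - V τ (q₁ τ)))) (Icc 0 T) τ := fun τ hτ => by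
    have he : HasDerivWithinAt (fun τ => Real.exp (N * τ)) (Real.exp (N * τ) * (N * 1))
        (Icc 0 T) τ := ((hasDerivAt_id τ).const_mul N).exp.hasDerivWithinAt
    have := (he.mul ((h₂ τ hτ).sub (h₁ τ hτ))).pow 2
    refine this.congr_deriv ?_
    simp only [Pi.mul_apply, Pi.sub_apply]
    push_cast
    ring
  have hmono : MonotoneOn E (Icc 0 T) := by
    refine monotoneOn_of_hasDerivWithinAt_nonneg (convex_Icc 0 T)
      (fun τ hτ => (hder τ hτ).continuousWithinAt)
      (fun τ hτ => (hder τ (interior_subset hτ)).mono interior_subset) fun τ hτ => ?_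
    have h := hV.abs_sub_le (interior_subset hτ) (q₂ τ) (q₁ τ)
    have h' : |(q₂ τ - q₁ τ) * (V τ (q₂ τ) - V τ (q₁ τ))| ≤ N * (q₂ τ - q₁ τ) ^ 2 := by
      rw [abs_mul, ← sq_abs (q₂ τ - q₁ τ)]
      nlinarith [abs_nonneg (q₂ τ - q₁ τ)]
    have := (abs_le.1 h').1
    exact mul_nonneg (by positivity) (by linarith)
  have h := sq_le_sq.1 (hmono hr ht hrt)
  rw [abs_mul, abs_mul, Real.abs_exp, Real.abs_exp] at h
  have h1 : 1 ≤ Real.exp (N * r) := Real.one_le_exp (mul_nonneg hN hr.1)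
  have h2 : Real.exp (N * t) ≤ Real.exp (N * T) :=
    Real.exp_le_exp.2 (mul_le_mul_of_nonneg_left ht.2 hN)
  nlinarith [abs_nonneg (q₂ r - q₁ r), abs_nonneg (q₂ t - q₁ t)]

/-- Chain rule along a curve for a function that is differentiable in `t` for each fixed `x`, with
`aₓ` jointly continuous. -/
lemma BddC1.hasDerivWithinAt_comp {T M : ℝ} {a : ℝ → ℝ → ℝ} (ha : BddC1 T M a) {q : ℝ → ℝ}
    {t q' r : ℝ} (ht : t ∈ Icc (0 : ℝ) T) (hq : HasDerivWithinAt q q' (Icc 0 T) t)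
    (hr : HasDerivWithinAt (fun τ => a τ (q t)) r (Icc 0 T) t) :
    HasDerivWithinAt (fun τ => a τ (q τ)) (r + deriv (a t) (q t) * q') (Icc 0 T) t := by
  set D := deriv (a t) (q t) with hD
  have hlo : (fun τ => a τ (q τ) - a τ (q t) - D * (q τ - q t)) =o[𝓝[Icc 0 T] t]
      fun τ => q τ - q t := by
    rw [Asymptotics.isLittleO_iff]
    intro ε hε
    obtain ⟨δ, hδ, hδ'⟩ := Metric.continuousWithinAt_iff.1 (ha.cont_deriv (t, q t) ⟨ht, mem_univ _⟩)
      ε hε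
    have h1 : ∀ᶠ τ in 𝓝[Icc 0 T] t, q τ ∈ Metric.ball (q t) δ :=
      hq.continuousWithinAt (Metric.ball_mem_nhds _ hδ)
    have h2 : ∀ᶠ τ in 𝓝[Icc 0 T] t, τ ∈ Metric.ball t δ :=
      mem_nhdsWithin_of_mem_nhds (Metric.ball_mem_nhds _ hδ)
    filter_upwards [h1, h2, self_mem_nhdsWithin] with τ hτ1 hτ2 hτ
    have hder : ∀ x, HasDerivAt (fun x => a τ x - D * x) (deriv (a τ) x - D * 1) x := fun x =>
      (ha.diff τ hτ x).hasDerivAt.sub ((hasDerivAt_id x).const_mul D)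
    have := (convex_ball (q t) δ).norm_image_sub_le_of_norm_hasDerivWithin_le (C := ε)
      (fun x _ => (hder x).hasDerivWithinAt) (fun x hx => by
        have := hδ' (x := (τ, x)) ⟨hτ, mem_univ _⟩ (by
          rw [Prod.dist_eq]; exact max_lt hτ2 hx)
        rw [mul_one]
        exact this.le) (Metric.mem_ball_self hδ) hτ1
    refine le_of_eq_of_le ?_ this
    congr 1; ring
  have h1 : HasDerivWithinAt (fun τ => a τ (q τ) - a τ (q t)) (D * q') (Icc 0 T) t := by
    have hO := hq.hasFDerivWithinAt.isBigO_sub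
    have hlo' := hlo.trans_isBigO hO
    rw [hasDerivWithinAt_iff_isLittleO]
    refine (hlo'.add ((hasDerivWithinAt_iff_isLittleO.1 (hq.const_mul D)))).congr_left fun τ => ?_
    simp only [sub_self, smul_eq_mul]
    ring
  exact ((hr.add h1).congr_of_mem (fun τ _ => by simp) ht)

/-- Integration of a bound on the derivative that grows like `e^{Lt}` gains a factor `1 / L`. -/
lemma abs_le_add_of_abs_deriv_le_exp {T P L : ℝ} (hP : 0 ≤ P) (hL : 0 < L) {f f' : ℝ → ℝ}
    (hf : ∀ t ∈ Icc (0 : ℝ) T, HasDerivWithinAt f (f' t) (Icc 0 T) t) {t₀ : ℝ}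
    (ht₀ : t₀ ∈ Icc (0 : ℝ) T) (hb : ∀ t ∈ Icc (0 : ℝ) t₀, |f' t| ≤ P * Real.exp (L * t)) :
    |f t₀| ≤ |f 0| + P / L * Real.exp (L * t₀) := by
  have hsub : Icc 0 t₀ ⊆ Icc 0 T := Icc_subset_Icc_right ht₀.2
  refine image_norm_le_of_norm_deriv_right_le_deriv_boundary (f := f) (f' := f')
    (B := fun t => |f 0| + P / L * Real.exp (L * t)) (B' := fun t => P * Real.exp (L * t))
    (a := 0) (b := t₀)
    (fun t ht => ((hf t (hsub ht)).mono hsub).continuousWithinAt)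
    (fun t ht => ((hf t (hsub (Ico_subset_Icc_self ht))).mono hsub).mono_of_mem_nhdsWithin
      (Icc_mem_nhdsGE_of_mem ht)) ?_ (fun t => ?_)
    (fun t ht => hb t (Ico_subset_Icc_self ht)) (right_mem_Icc.2 ht₀.1)
  · exact le_add_of_nonneg_right (by positivity)
  · refine ((((hasDerivAt_id t).const_mul L).exp.const_mul (P / L)).const_add _).congr_deriv ?_
    simp only [id]
    field_simp

/-! ### Propagation of the weighted bound -/

lemma abs_deriv_le_of_abs_sub_le {f : ℝ → ℝ} {x K : ℝ} (hf : DifferentiableAt ℝ f x)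
    (h : ∀ d, 0 < d → d ≤ 1 → |f (x + d) - f x| ≤ K * d) : |deriv f x| ≤ K := by
  refine le_of_tendsto hf.hasDerivAt.tendsto_slope_zero_right.norm ?_
  filter_upwards [Ioc_mem_nhdsGT (zero_lt_one' ℝ)] with d hd
  rw [norm_smul, norm_inv, Real.norm_of_nonneg hd.1.le, inv_mul_le_iff₀ hd.1, mul_comm]
  exact h d hd.1 hd.2

/-- Along a characteristic the transport term cancels. -/
lemma hasDerivWithinAt_along_characteristic {T M : ℝ} {a b c : ℝ → ℝ → ℝ} (ha : BddC1 T M a)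
    (heq : ∀ t ∈ Icc (0 : ℝ) T, ∀ x : ℝ,
      HasDerivWithinAt (fun τ => a τ x) (-spatialPart (a t) (b t) (c t) x) (Icc 0 T) t)
    {q : ℝ → ℝ} (hq : IsCharacteristic T (fun t x => a t x + b t x + c t x) q) {t : ℝ}
    (ht : t ∈ Icc (0 : ℝ) T) :
    HasDerivWithinAt (fun τ => a τ (q τ)) (-nonlocalPart (a t) (b t) (c t) (q t)) (Icc 0 T) t := by
  refine (ha.hasDerivWithinAt_comp ht (hq t ht) (heq t ht (q t))).congr_deriv ?_
  unfold spatialPart nonlocalPart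
  ring

/-- The weighted estimate for one component. The bound `B e^{Lt}` assumed for all components
returns with the factor `C / L`, which is small when `L` is large. -/
lemma component_estimate {α M T : ℝ} (hα0 : 0 ≤ α) (hα : α < 1) (hM : 0 ≤ M) (hT : 0 ≤ T) :
    ∃ C : ℝ, 0 < C ∧ ∀ (a b c : ℝ → ℝ → ℝ), BddC1 T M a → BddC1 T M b → BddC1 T M c →
      (∀ t ∈ Icc (0 : ℝ) T, ∀ x : ℝ,
        HasDerivWithinAt (fun τ => a τ x) (-spatialPart (a t) (b t) (c t) x) (Icc 0 T) t) →
      ∀ (ψ : ℝ → ℝ) (A B L : ℝ), IsExpWeight α ψ → 0 ≤ A → 0 ≤ B → 0 < L → C1Le A ψ (a 0) →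
      (∀ t ∈ Icc (0 : ℝ) T, C1Le (B * Real.exp (L * t)) ψ (a t) ∧
        C1Le (B * Real.exp (L * t)) ψ (b t) ∧ C1Le (B * Real.exp (L * t)) ψ (c t)) →
      ∀ t ∈ Icc (0 : ℝ) T, C1Le ((C * A + C / L * B) * Real.exp (L * t)) ψ (a t) := by
  set N := M + M + M with hN
  set D := Real.exp (N * T) with hD
  set R := Real.exp (α * (N * T)) with hR
  obtain ⟨κ, hκ, hnl⟩ := nonlocalPart_bounds (D := D) hα hM
  have hN0 : 0 ≤ N := by positivity
  have hD1 : 1 ≤ D := Real.one_le_exp (by positivity)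
  have hR0 : 0 < R := Real.exp_pos _
  have hE1 : 1 ≤ Real.exp (α * D) := Real.one_le_exp (by positivity)
  set C := R * D * Real.exp (α * D) * (1 + κ) with hC
  refine ⟨C, by positivity, fun a b c ha hb hc heq ψ A B L hψ hA hB hL hinit hbd t ht y => ?_⟩
  have hV : BddC1 T N (fun t x => a t x + b t x + c t x) := (ha.add hb).add hc
  have h0 : (0 : ℝ) ∈ Icc (0 : ℝ) T := ⟨le_rfl, hT⟩
  have hψy := hψ.pos y
  have hexp : 1 ≤ Real.exp (L * t) := Real.one_le_exp (mul_nonneg hL.le ht.1)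
  obtain ⟨q, hqt, hq⟩ := hV.exists_characteristic ht y
  -- the weight along the characteristic through `(t, y)` is comparable to its value at `y`
  have hψq : ∀ τ ∈ Icc (0 : ℝ) T, ψ (q τ) ≤ R * ψ y := fun τ hτ => by
    refine (hψ.le y (q τ)).trans (mul_le_mul_of_nonneg_right ?_ hψy.le)
    rw [hR, Real.exp_le_exp, ← hqt]
    exact mul_le_mul_of_nonneg_left (hq.abs_sub_le hV ht hτ) hα0
  have hC1 : ∀ {w : ℝ → ℝ → ℝ}, BddC1 T M w → ∀ τ ∈ Icc (0 : ℝ) T, C1Le M 1 (w τ) :=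
    fun hw τ hτ x => by
      simpa using And.intro (hw.abs_le τ hτ x) (hw.abs_deriv_le τ hτ x)
  have hnl' : ∀ τ ∈ Icc (0 : ℝ) T, ∀ x, _ := fun τ hτ x =>
    hnl ψ (a τ) (b τ) (c τ) (B * Real.exp (L * τ)) hψ (by positivity) (ha.diff τ hτ)
      (hb.diff τ hτ) (hc.diff τ hτ) (hC1 ha τ hτ) (hC1 hb τ hτ) (hC1 hc τ hτ) (hbd τ hτ).1
      (hbd τ hτ).2.1 (hbd τ hτ).2.2 x
  have hCR : R ≤ R * D * Real.exp (α * D) := by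
    rw [mul_assoc]; exact le_mul_of_one_le_right hR0.le (one_le_mul_of_one_le_of_one_le hD1 hE1)
  have hCD : R * D ≤ R * D * Real.exp (α * D) :=
    le_mul_of_one_le_right (by positivity) hE1
  constructor
  · have h := abs_le_add_of_abs_deriv_le_exp (P := κ * B * (R * ψ y)) (by positivity) hL
      (fun τ hτ => hasDerivWithinAt_along_characteristic ha heq hq hτ) ht (fun τ hτ => by
        have hτ' : τ ∈ Icc (0 : ℝ) T := Icc_subset_Icc_right ht.2 hτ
        rw [abs_neg]
        calc _ ≤ κ * (B * Real.exp (L * τ)) * ψ (q τ) := (hnl' τ hτ' (q τ)).1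
          _ ≤ κ * (B * Real.exp (L * τ)) * (R * ψ y) :=
            mul_le_mul_of_nonneg_left (hψq τ hτ') (by positivity)
          _ = _ := by ring)
    rw [hqt] at h
    have h1 : |a 0 (q 0)| ≤ A * (R * ψ y) :=
      (hinit _).1.trans (mul_le_mul_of_nonneg_left (hψq 0 h0) hA)
    calc |a t y| ≤ A * (R * ψ y) * 1 + κ * B * (R * ψ y) / L * Real.exp (L * t) := by linarith
      _ ≤ A * (R * ψ y) * Real.exp (L * t) + κ * B * (R * ψ y) / L * Real.exp (L * t) := by gcongr
      _ = (R * A + R * κ / L * B) * Real.exp (L * t) * ψ y := by ring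
      _ ≤ (C * A + C / L * B) * Real.exp (L * t) * ψ y := by
        have e1 : R ≤ C := hCR.trans (le_mul_of_one_le_right (by positivity) (by linarith))
        have e2 : R * κ ≤ C := mul_le_mul hCR (by linarith) hκ (by positivity)
        gcongr
  · -- compare with the characteristic that passes through `y + d` at time `t`
    refine abs_deriv_le_of_abs_sub_le (ha.diff t ht y) fun d hd hd1 => ?_
    obtain ⟨q₂, hq₂t, hq₂⟩ := hV.exists_characteristic ht (y + d)
    have hsep : ∀ τ ∈ Icc (0 : ℝ) t, |q₂ τ - q τ| ≤ D * d := fun τ hτ => by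
      have := hq.abs_sub_le_exp hq₂ hV (Icc_subset_Icc_right ht.2 hτ) ht hτ.2
      rwa [hq₂t, hqt, add_sub_cancel_left, abs_of_pos hd] at this
    have hDd : D * d ≤ D := mul_le_of_le_one_right (by positivity) hd1
    have h := abs_le_add_of_abs_deriv_le_exp (P := κ * B * (R * ψ y) * (D * d)) (by positivity) hL
      (fun τ hτ => (hasDerivWithinAt_along_characteristic ha heq hq₂ hτ).sub
        (hasDerivWithinAt_along_characteristic ha heq hq hτ)) ht (fun τ hτ => by
        have hτ' : τ ∈ Icc (0 : ℝ) T := Icc_subset_Icc_right ht.2 hτ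
        have hs := hsep τ hτ
        have := (hnl' τ hτ' (q τ)).2 (q₂ τ - q τ) (hs.trans hDd)
        rw [add_sub_cancel] at this
        rw [neg_sub_neg, abs_sub_comm]
        calc _ ≤ κ * (B * Real.exp (L * τ)) * ψ (q τ) * |q₂ τ - q τ| := this
          _ ≤ κ * (B * Real.exp (L * τ)) * (R * ψ y) * (D * d) := by
            have := hψq τ hτ'
            gcongr
          _ = _ := by ring)
    simp only [Pi.sub_apply] at h
    rw [hqt, hq₂t] at h
    have hs0 := hsep 0 ⟨le_rfl, ht.1⟩
    have h1 : |a 0 (q₂ 0) - a 0 (q 0)| ≤ A * (Real.exp (α * D) * (R * ψ y)) * (D * d) := by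
      have hmv := (convex_closedBall (q 0) D).norm_image_sub_le_of_norm_deriv_le
        (f := a 0) (C := A * (Real.exp (α * D) * (R * ψ y))) (x := q 0) (y := q₂ 0)
        (fun z _ => ha.diff 0 h0 z) (fun z hz => ?_)
        (Metric.mem_closedBall_self (by positivity)) (hs0.trans hDd)
      · exact hmv.trans (mul_le_mul_of_nonneg_left hs0 (by positivity))
      · refine (hinit z).2.trans (mul_le_mul_of_nonneg_left ?_ hA)
        refine (hψ.le (q 0) z).trans ?_
        have e1 : |q 0 - z| ≤ D := by
          rw [abs_sub_comm]; exact hz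
        have e2 := hψq 0 h0
        have e3 := (hψ.pos (q 0)).le
        gcongr
    calc |a t (y + d) - a t y|
        ≤ A * (Real.exp (α * D) * (R * ψ y)) * (D * d) * 1
          + κ * B * (R * ψ y) * (D * d) / L * Real.exp (L * t) := by linarith
      _ ≤ A * (Real.exp (α * D) * (R * ψ y)) * (D * d) * Real.exp (L * t)
          + κ * B * (R * ψ y) * (D * d) / L * Real.exp (L * t) := by gcongr
      _ = ((R * D * Real.exp (α * D)) * A + R * D * κ / L * B) * Real.exp (L * t) * ψ y * d := by
        ring
      _ ≤ (C * A + C / L * B) * Real.exp (L * t) * ψ y * d := by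
        have e1 : R * D * Real.exp (α * D) ≤ C :=
          le_mul_of_one_le_right (by positivity) (by linarith)
        have e2 : R * D * κ ≤ C := mul_le_mul hCD (by linarith) hκ (by positivity)
        gcongr

/-- Weighted bound for the solution, with a constant that depends on the weight only through its
exponential rate and the bound `A` of the data. -/
lemma exists_weighted_bound {α M T : ℝ} (hα0 : 0 ≤ α) (hα : α < 1) (hM : 0 ≤ M) (hT : 0 ≤ T) :
    ∃ K : ℝ, 0 < K ∧ ∀ u v w : ℝ → ℝ → ℝ, BddC1 T M u → BddC1 T M v → BddC1 T M w →
      (∀ t ∈ Icc (0 : ℝ) T, ∀ x : ℝ,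
        HasDerivWithinAt (fun τ => u τ x) (-spatialPart (u t) (v t) (w t) x) (Icc 0 T) t) →
      (∀ t ∈ Icc (0 : ℝ) T, ∀ x : ℝ,
        HasDerivWithinAt (fun τ => v τ x) (-spatialPart (v t) (u t) (w t) x) (Icc 0 T) t) →
      (∀ t ∈ Icc (0 : ℝ) T, ∀ x : ℝ,
        HasDerivWithinAt (fun τ => w τ x) (-spatialPart (w t) (u t) (v t) x) (Icc 0 T) t) →
      ∀ (ψ : ℝ → ℝ) (ε A : ℝ), IsExpWeight α ψ → 0 < ε → (∀ x, ε ≤ ψ x) → 0 ≤ A →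
      C1Le A ψ (u 0) → C1Le A ψ (v 0) → C1Le A ψ (w 0) →
      ∀ t ∈ Icc (0 : ℝ) T, C1Le (K * A) ψ (u t) ∧ C1Le (K * A) ψ (v t) ∧ C1Le (K * A) ψ (w t) := by
  obtain ⟨C, hC, hest⟩ := component_estimate hα0 hα hM hT
  refine ⟨2 * C * Real.exp (2 * C * T), by positivity,
    fun u v w hu hv hw equ eqv eqw ψ ε A hψ hε hψε hA iu iv iw => ?_⟩
  have hL : 0 < 2 * C := by positivity
  have hCL : C / (2 * C) = 1 / 2 := by field_simp
  -- the a priori bound `M / ε` improves under iteration of `B ↦ C A + B / 2`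
  have hiter : ∀ n : ℕ, ∀ t ∈ Icc (0 : ℝ) T,
      C1Le ((2 * C * A + M / ε * (1 / 2) ^ n) * Real.exp (2 * C * t)) ψ (u t) ∧
      C1Le ((2 * C * A + M / ε * (1 / 2) ^ n) * Real.exp (2 * C * t)) ψ (v t) ∧
      C1Le ((2 * C * A + M / ε * (1 / 2) ^ n) * Real.exp (2 * C * t)) ψ (w t) := by
    intro n
    induction n with
    | zero =>
      intro t ht
      have hb : ∀ x, M ≤ (2 * C * A + M / ε * (1 / 2) ^ 0) * Real.exp (2 * C * t) * ψ x :=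
        fun x => by
        have h1 : 1 ≤ Real.exp (2 * C * t) := Real.one_le_exp (mul_nonneg hL.le ht.1)
        have h2 : M / ε ≤ (2 * C * A + M / ε * (1 / 2) ^ 0) * Real.exp (2 * C * t) := by
          have h3 : 0 ≤ 2 * C * A := by positivity
          have h4 : 0 ≤ M / ε := by positivity
          rw [pow_zero]
          nlinarith
        calc M = M / ε * ε := by field_simp
          _ ≤ _ := mul_le_mul h2 (hψε x) hε.le ((by positivity : 0 ≤ M / ε).trans h2)
      exact ⟨fun x => ⟨(hu.abs_le t ht x).trans (hb x), (hu.abs_deriv_le t ht x).trans (hb x)⟩,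
        fun x => ⟨(hv.abs_le t ht x).trans (hb x), (hv.abs_deriv_le t ht x).trans (hb x)⟩,
        fun x => ⟨(hw.abs_le t ht x).trans (hb x), (hw.abs_deriv_le t ht x).trans (hb x)⟩⟩
    | succ n ih =>
      set B := 2 * C * A + M / ε * (1 / 2) ^ n with hB
      have hB0 : 0 ≤ B := by positivity
      have hnext : C * A + C / (2 * C) * B = 2 * C * A + M / ε * (1 / 2) ^ (n + 1) := by
        rw [hCL, hB, pow_succ]; ring
      intro t ht
      rw [← hnext]
      exact ⟨hest u v w hu hv hw equ ψ A B (2 * C) hψ hA hB0 hL iu ih t ht,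
        hest v u w hv hu hw eqv ψ A B (2 * C) hψ hA hB0 hL iv
          (fun τ hτ => ⟨(ih τ hτ).2.1, (ih τ hτ).1, (ih τ hτ).2.2⟩) t ht,
        hest w u v hw hu hv eqw ψ A B (2 * C) hψ hA hB0 hL iw
          (fun τ hτ => ⟨(ih τ hτ).2.2, (ih τ hτ).1, (ih τ hτ).2.1⟩) t ht⟩
  intro t ht
  have hlim : ∀ p x : ℝ,
      (∀ n : ℕ, p ≤ (2 * C * A + M / ε * (1 / 2) ^ n) * Real.exp (2 * C * t) * ψ x) →
      p ≤ 2 * C * Real.exp (2 * C * T) * A * ψ x := fun p x hp => by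
    have h1 : Tendsto (fun n : ℕ => (2 * C * A + M / ε * (1 / 2) ^ n) * Real.exp (2 * C * t) * ψ x)
        atTop (𝓝 ((2 * C * A + M / ε * 0) * Real.exp (2 * C * t) * ψ x)) :=
      ((((tendsto_pow_atTop_nhds_zero_of_lt_one (by norm_num) (by norm_num)).const_mul
        _).const_add _).mul_const _).mul_const _
    refine (ge_of_tendsto' h1 hp).trans ?_
    have h2 : Real.exp (2 * C * t) ≤ Real.exp (2 * C * T) :=
      Real.exp_le_exp.2 (mul_le_mul_of_nonneg_left ht.2 hL.le)
    have h3 := (hψ.pos x).le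
    calc (2 * C * A + M / ε * 0) * Real.exp (2 * C * t) * ψ x
        = 2 * C * A * Real.exp (2 * C * t) * ψ x := by ring
      _ ≤ 2 * C * A * Real.exp (2 * C * T) * ψ x := by gcongr
      _ = _ := by ring
  exact ⟨fun x => ⟨hlim _ x fun n => ((hiter n t ht).1 x).1,
      hlim _ x fun n => ((hiter n t ht).1 x).2⟩,
    fun x => ⟨hlim _ x fun n => ((hiter n t ht).2.1 x).1,
      hlim _ x fun n => ((hiter n t ht).2.1 x).2⟩,
    fun x => ⟨hlim _ x fun n => ((hiter n t ht).2.2 x).1,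
      hlim _ x fun n => ((hiter n t ht).2.2 x).2⟩⟩

lemma isExpWeight_exp_add {α ε : ℝ} (hα : 0 ≤ α) (hε : 0 < ε) :
    IsExpWeight α fun x => Real.exp (α * x) + ε where
  pos x := by positivity
  le x y := by
    have h1 : Real.exp (α * y) ≤ Real.exp (α * |x - y|) * Real.exp (α * x) := by
      rw [← Real.exp_add, Real.exp_le_exp]
      nlinarith [neg_abs_le (x - y)]
    have h2 : 1 ≤ Real.exp (α * |x - y|) := Real.one_le_exp (by positivity)
    nlinarith

/-- A bounded function that decays like `e^{αx}` at `-∞` is bounded by a multiple of `e^{αx}` on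
the whole line. -/
lemma ExpDecay.exists_forall_le {α M : ℝ} (hα : 0 ≤ α) {φ : ℝ → ℝ} (h : ExpDecay α φ)
    (hM : ∀ x, |φ x| ≤ M) : ∃ A, 0 ≤ A ∧ ∀ x, |φ x| ≤ A * Real.exp (α * x) := by
  have hM0 : 0 ≤ M := (abs_nonneg _).trans (hM 0)
  obtain ⟨c, hc, hb⟩ := h.exists_nonneg
  obtain ⟨X, hX⟩ := eventually_atBot.1 hb.bound
  refine ⟨c + M * Real.exp (-(α * X)), by positivity, fun x => ?_⟩
  rw [add_mul, mul_assoc, ← Real.exp_add]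
  rcases le_total x X with hx | hx
  · have := hX x hx
    rw [Real.norm_eq_abs, Real.norm_of_nonneg (Real.exp_pos _).le] at this
    exact this.trans (le_add_of_nonneg_right (by positivity))
  · have h1 : 1 ≤ Real.exp (-(α * X) + α * x) :=
      Real.one_le_exp (by nlinarith)
    exact (hM x).trans ((le_mul_of_one_le_right hM0 h1).trans
      (le_add_of_nonneg_left (by positivity)))

lemma ExpDecay.exists_c1Le {α M T : ℝ} (hα : 0 ≤ α) (hT : 0 ≤ T) {a : ℝ → ℝ → ℝ}
    (ha : BddC1 T M a) (h : ExpDecay α (a 0)) (h' : ExpDecay α (deriv (a 0))) :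
    ∃ A, 0 ≤ A ∧ C1Le A (fun x => Real.exp (α * x)) (a 0) := by
  obtain ⟨A, hA, h1⟩ := h.exists_forall_le hα (ha.abs_le 0 ⟨le_rfl, hT⟩)
  obtain ⟨A', hA', h2⟩ := h'.exists_forall_le hα (ha.abs_deriv_le 0 ⟨le_rfl, hT⟩)
  refine ⟨A + A', by positivity, fun x => ⟨(h1 x).trans ?_, (h2 x).trans ?_⟩⟩ <;>
  · gcongr
    linarith

lemma C1Le.mono {S S' : ℝ} {ψ ψ' a : ℝ → ℝ} (h : C1Le S ψ a) (hS : S ≤ S') (hS' : 0 ≤ S')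
    (hψ : ∀ x, 0 ≤ ψ x) (hψ' : ∀ x, ψ x ≤ ψ' x) : C1Le S' ψ' a := fun x =>
  have hx : S * ψ x ≤ S' * ψ' x := mul_le_mul hS (hψ' x) (hψ x) hS'
  ⟨(h x).1.trans hx, (h x).2.trans hx⟩

end

end ThreeCH

open ThreeCH in
theorem theorem3p1 (s T α : ℝ) (hs : 3 / 2 < s) (hT : 0 < T) (hα : α ∈ Set.Ioo (0 : ℝ) 1)
    (u₀ v₀ w₀ : ℝ → ℝ) (u v w : ℝ → ℝ → ℝ)
    (hu₀ : ThreeCH.MemHs s u₀) (hv₀ : ThreeCH.MemHs s v₀) (hw₀ : ThreeCH.MemHs s w₀)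
    (hsol : ThreeCH.IsSolution s T u₀ v₀ w₀ u v w)
    (hu : ThreeCH.ExpDecay α u₀) (hv : ThreeCH.ExpDecay α v₀) (hw : ThreeCH.ExpDecay α w₀)
    (hux : ThreeCH.ExpDecay α (deriv u₀)) (hvx : ThreeCH.ExpDecay α (deriv v₀))
    (hwx : ThreeCH.ExpDecay α (deriv w₀)) :
    ThreeCH.UnifExpDecay α T u ∧ ThreeCH.UnifExpDecay α T v ∧ ThreeCH.UnifExpDecay α T w ∧
    ThreeCH.UnifExpDecay α T (fun t => deriv (u t)) ∧
    ThreeCH.UnifExpDecay α T (fun t => deriv (v t)) ∧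
    ThreeCH.UnifExpDecay α T (fun t => deriv (w t)) := by
  obtain ⟨hα0, hα1⟩ := hα
  obtain ⟨Mu, bu⟩ := hsol.u_mem.exists_bddC1 hs hsol.u_cont
  obtain ⟨Mv, bv⟩ := hsol.v_mem.exists_bddC1 hs hsol.v_cont
  obtain ⟨Mw, bw⟩ := hsol.w_mem.exists_bddC1 hs hsol.w_cont
  set M := max (max Mu Mv) Mw with hM
  replace bu : BddC1 T M u := bu.mono ((le_max_left _ _).trans (le_max_left _ _))
  replace bv : BddC1 T M v := bv.mono ((le_max_right _ _).trans (le_max_left _ _))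
  replace bw : BddC1 T M w := bw.mono (le_max_right _ _)
  have hM0 : 0 ≤ M := (abs_nonneg _).trans (bu.abs_le 0 ⟨le_rfl, hT.le⟩ 0)
  rw [← hsol.u_init] at hu hux
  rw [← hsol.v_init] at hv hvx
  rw [← hsol.w_init] at hw hwx
  obtain ⟨Au, hAu, iu⟩ := hu.exists_c1Le hα0.le hT.le bu hux
  obtain ⟨Av, hAv, iv⟩ := hv.exists_c1Le hα0.le hT.le bv hvx
  obtain ⟨Aw, hAw, iw⟩ := hw.exists_c1Le hα0.le hT.le bw hwx
  obtain ⟨K, hK, hbound⟩ := exists_weighted_bound hα0.le hα1 hM0 hT.le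
  -- the summand `1` makes the final constant positive
  set A := Au + Av + Aw + 1 with hA
  have hA0 : 0 < A := by positivity
  have hpos : ∀ x : ℝ, 0 ≤ Real.exp (α * x) := fun x => (Real.exp_pos _).le
  have hmain : ∀ ε : ℝ, 0 < ε → ∀ t ∈ Set.Icc (0 : ℝ) T,
      C1Le (K * A) (fun x => Real.exp (α * x) + ε) (u t) ∧
      C1Le (K * A) (fun x => Real.exp (α * x) + ε) (v t) ∧
      C1Le (K * A) (fun x => Real.exp (α * x) + ε) (w t) := fun ε hε => by
    have hle : ∀ x : ℝ, Real.exp (α * x) ≤ Real.exp (α * x) + ε := fun x => by linarith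
    exact hbound u v w bu bv bw hsol.u_eq hsol.v_eq hsol.w_eq _ ε A
      (isExpWeight_exp_add hα0.le hε) hε (fun x => by linarith [hpos x]) hA0.le
      (iu.mono (by linarith) hA0.le hpos hle) (iv.mono (by linarith) hA0.le hpos hle)
      (iw.mono (by linarith) hA0.le hpos hle)
  have hconcl : ∀ φ : ℝ → ℝ → ℝ, (∀ ε : ℝ, 0 < ε → ∀ t ∈ Set.Icc (0 : ℝ) T, ∀ x,
      |φ t x| ≤ K * A * (Real.exp (α * x) + ε)) → UnifExpDecay α T φ := fun φ hφ => by
    refine ⟨K * A, by positivity, 0, fun x _ t ht => le_of_forall_pos_le_add fun δ hδ => ?_⟩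
    have := hφ (δ / (K * A)) (by positivity) t ht x
    rwa [mul_add, mul_div_cancel₀ _ (by positivity)] at this
  exact ⟨hconcl _ fun ε hε t ht x => ((hmain ε hε t ht).1 x).1,
    hconcl _ fun ε hε t ht x => ((hmain ε hε t ht).2.1 x).1,
    hconcl _ fun ε hε t ht x => ((hmain ε hε t ht).2.2 x).1,
    hconcl _ fun ε hε t ht x => ((hmain ε hε t ht).1 x).2,
    hconcl _ fun ε hε t ht x => ((hmain ε hε t ht).2.1 x).2,
    hconcl _ fun ε hε t ht x => ((hmain ε hε t ht).2.2 x).2⟩
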